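/- Let $R$ be a left Noetherian (associative, unital, not necessarily commutative) ring. For a left $R$-module $M$ let $$0\to M\to E^0(M)\to E^1(M)\to E^2(M)\to\cdots$$ be a minimal injective coresolution, i.e. an exact sequence with all $E^n(M)$ injective in which the image of $M$ is essential in $E^0(M)$ and the image of $E^{n}(M)$ is essential in $E^{n+1}(M)$ for every $n\ge 0$; the module $E^n(M)$ is unique up to isomorphism. Let $\operatorname{fd}_R X\in\mathbb{N}\cup\{\infty\}$ denote the flat dimension of a left $R$-module $X$, i.e. the least $k\ge 0$ such that there is an exact sequence $0\to F_k\to\cdots\to F_0\to X\to 0$ with all $F_i$ flat (and $\infty$ if there is none; in particular $\operatorname{fd}_R 0=0$). (1) Let $n,k\ge 0$, let $I$ be a (nonempty) directed index set, let $\{M_i\}_{i\in I}$ be a directed system of left $R$-modules, and let $M=\varinjlim_{i\in I}M_i$. If $\operatorname{fd}_R E^n(M_i)\le k$ for all $i\in I$, then $\operatorname{fd}_R E^n(M)\le k$. (2) For every $n\ge 0$, $$\operatorname{fd}_R E^n({}_RR)=\sup\{\operatorname{fd}_R E^n(F)\mid F \text{ a flat left } R\text{-module}\}.$$ -/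

import Mathlib

open scoped TensorProduct

universe u v w x y

/-- The subgroup of `N ⊗[ℤ] M` generated by the elements `n·r ⊗ m - n ⊗ r·m`, for a right `R`-module
`N` (a module over `Rᵐᵒᵖ`) and a left `R`-module `M`. -/
def balancedRelations (R : Type u) [Ring R] (N : Type w) [AddCommGroup N] [Module Rᵐᵒᵖ N]
    (M : Type v) [AddCommGroup M] [Module R M] : AddSubgroup (N ⊗[ℤ] M) :=
  AddSubgroup.closure {t | ∃ (n : N) (r : R) (m : M),
    t = (MulOpposite.op r • n) ⊗ₜ[ℤ] m - n ⊗ₜ[ℤ] (r • m)}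

/-- The abelian group `N ⊗_R M` for a right module `N` and a left module `M` over a (possibly
noncommutative) ring `R`. -/
abbrev BalancedTensor (R : Type u) [Ring R] (N : Type w) [AddCommGroup N] [Module Rᵐᵒᵖ N]
    (M : Type v) [AddCommGroup M] [Module R M] : Type (max w v) :=
  (N ⊗[ℤ] M) ⧸ balancedRelations R N M

theorem balancedRelations_le_comap {R : Type u} [Ring R] {N : Type w} [AddCommGroup N]
    [Module Rᵐᵒᵖ N] {N' : Type x} [AddCommGroup N'] [Module Rᵐᵒᵖ N'] (f : N →ₗ[Rᵐᵒᵖ] N')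
    (M : Type v) [AddCommGroup M] [Module R M] :
    balancedRelations R N M ≤
      (balancedRelations R N' M).comap
        (f.toAddMonoidHom.toIntLinearMap.rTensor M).toAddMonoidHom := by
  refine (AddSubgroup.closure_le _).mpr ?_
  rintro _ ⟨n, r, m, rfl⟩
  refine AddSubgroup.subset_closure ⟨f n, r, m, ?_⟩
  simp

/-- The homomorphism `f ⊗ 1 : N ⊗_R M → N' ⊗_R M`. -/
def BalancedTensor.map {R : Type u} [Ring R] {N : Type w} [AddCommGroup N]
    [Module Rᵐᵒᵖ N] {N' : Type x} [AddCommGroup N'] [Module Rᵐᵒᵖ N'] (f : N →ₗ[Rᵐᵒᵖ] N')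
    (M : Type v) [AddCommGroup M] [Module R M] :
    BalancedTensor R N M →+ BalancedTensor R N' M :=
  QuotientAddGroup.map _ _ (f.toAddMonoidHom.toIntLinearMap.rTensor M).toAddMonoidHom
    (balancedRelations_le_comap f M)

/-- A left module `M` over a ring `R` is flat if `- ⊗_R M` preserves injectivity of homomorphisms
of right `R`-modules. (Right modules in the universe of `R` suffice, since right ideals do.) -/
def IsFlatModule (R : Type u) [Ring R] (M : Type v) [AddCommGroup M] [Module R M] : Prop :=
  ∀ ⦃N N' : Type u⦄ [AddCommGroup N] [AddCommGroup N'] [Module Rᵐᵒᵖ N] [Module Rᵐᵒᵖ N']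
    (f : N →ₗ[Rᵐᵒᵖ] N'), Function.Injective f → Function.Injective (BalancedTensor.map f M)

/-- A flat resolution `⋯ → F₁ → F₀ → M → 0` of a left `R`-module `M`. -/
structure FlatResolution (R : Type u) [Ring R] (M : Type v) [AddCommGroup M] [Module R M] where
  F : ℕ → Type (max u v)
  [addCommGroup : ∀ i, AddCommGroup (F i)]
  [module : ∀ i, Module R (F i)]
  ε : F 0 →ₗ[R] M
  d : ∀ i, F (i + 1) →ₗ[R] F i
  flat : ∀ i, IsFlatModule R (F i)
  surjective_ε : Function.Surjective ε
  exact_zero : Function.Exact (d 0) ε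
  exact_succ : ∀ i, Function.Exact (d (i + 1)) (d i)

attribute [instance] FlatResolution.addCommGroup FlatResolution.module

/-- The flat dimension of a left `R`-module `M`: the least length `k` of a flat resolution
`0 → F_k → ⋯ → F₀ → M → 0`, and `⊤` if there is none of finite length. -/
noncomputable def flatDimension (R : Type u) [Ring R] (M : Type v) [AddCommGroup M] [Module R M] :
    ℕ∞ :=
  sInf {e | ∃ (k : ℕ) (P : FlatResolution R M), (∀ i, k < i → Subsingleton (P.F i)) ∧ e = k}

/-- A submodule is essential if it meets every nonzero submodule nontrivially. -/
def IsEssentialSubmodule {R : Type u} [Ring R] {E : Type v} [AddCommGroup E] [Module R E]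
    (A : Submodule R E) : Prop :=
  ∀ N : Submodule R E, N ⊓ A = ⊥ → N = ⊥

/-- A minimal injective coresolution `0 → M → E⁰ → E¹ → ⋯` of a left `R`-module `M`: an exact
sequence with injective terms in which `M → E⁰` and each `Eⁿ / im → Eⁿ⁺¹` is an injective
envelope, i.e. has essential image. The terms live in a universe large enough for the ring, so that
`Module.Injective` is injectivity in the category of all modules. -/
structure MinimalInjectiveCoresolution (R : Type u) [Ring R] (M : Type v) [AddCommGroup M]
    [Module R M] where
  E : ℕ → Type (max u v)
  [addCommGroup : ∀ n, AddCommGroup (E n)]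
  [module : ∀ n, Module R (E n)]
  ι : M →ₗ[R] E 0
  d : ∀ n, E n →ₗ[R] E (n + 1)
  injective : ∀ n, Module.Injective R (E n)
  injective_ι : Function.Injective ι
  exact_zero : Function.Exact ι (d 0)
  exact_succ : ∀ n, Function.Exact (d n) (d (n + 1))
  essential_zero : IsEssentialSubmodule (LinearMap.range ι)
  essential_succ : ∀ n, IsEssentialSubmodule (LinearMap.range (d n))

attribute [instance] MinimalInjectiveCoresolution.addCommGroup MinimalInjectiveCoresolution.module


/-- Every module embeds as an essential submodule of an injective module. -/
theorem exists_injective_envelope (R : Type u) [Ring R] (M : ModuleCat.{max u v} R) :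
    ∃ (Q : ModuleCat.{max u v} R) (i : M →ₗ[R] Q), Function.Injective i ∧
      Module.Injective R Q ∧ IsEssentialSubmodule (LinearMap.range i) := by
  obtain ⟨pres⟩ := (ModuleCat.enoughInjectives.{v} R).presentation M
  obtain ⟨Q, hQ, j, hj⟩ := pres
  have hQ' : Module.Injective R Q := Module.injective_module_of_injective_object R Q
  have hj' : Function.Injective j.hom := (ModuleCat.mono_iff_injective j).1 hj
  set A : Submodule R Q := LinearMap.range j.hom with hA
  have key : ∀ P : Submodule R Q → Prop,
      (∀ c : Set (Submodule R Q), c.Nonempty → IsChain (· ≤ ·) c → (∀ B ∈ c, P B) → P (sSup c)) →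
      ∀ B₀, P B₀ → ∃ B, B₀ ≤ B ∧ P B ∧ ∀ B', P B' → B ≤ B' → B' = B := by
    intro P hP B₀ hB₀
    obtain ⟨B, hB, hmax⟩ := zorn_le_nonempty₀ {B | P B} (fun c hc hch y hy =>
      ⟨sSup c, hP c ⟨y, hy⟩ hch hc, fun z hz => le_sSup hz⟩) B₀ hB₀
    exact ⟨B, hB, hmax.prop, fun B' h1 h2 => le_antisymm (hmax.le_of_ge h1 h2) h2⟩
  obtain ⟨B, hAB, hB, hBmax⟩ := key
    (fun B => ∀ N ≤ B, N ⊓ A = ⊥ → N = ⊥) (by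
      intro c hne hch hc N hN hNA
      rw [eq_bot_iff]
      intro t ht
      obtain ⟨B, hBc, htB⟩ := (Submodule.mem_sSup_of_directed hne hch.directedOn).1 (hN ht)
      have h1 : N ⊓ B = ⊥ := hc B hBc (N ⊓ B) inf_le_right (by
        rw [eq_bot_iff, ← hNA]; exact inf_le_inf_right _ inf_le_left)
      rw [← h1]; exact ⟨ht, htB⟩) A (fun N hN h => by rwa [inf_eq_left.2 hN] at h)
  obtain ⟨C, -, hC, hCmax⟩ := key (fun C => C ⊓ B = ⊥) (by
      intro c hne hch hc
      rw [eq_bot_iff]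
      rintro t ⟨ht, htB⟩
      obtain ⟨D, hDc, htD⟩ := (Submodule.mem_sSup_of_directed hne hch.directedOn).1 ht
      rw [← hc D hDc]; exact ⟨htD, htB⟩) ⊥ (by simp)
  have hinj : Function.Injective (C.mkQ ∘ₗ B.subtype) := by
    rw [← LinearMap.ker_eq_bot, eq_bot_iff]
    intro b hb
    have : (b : Q) ∈ C ⊓ B := ⟨by simpa using hb, b.2⟩
    rw [hC] at this
    simpa using this
  obtain ⟨g, hg⟩ := hQ'.out (C.mkQ ∘ₗ B.subtype) hinj B.subtype
  set h : Q →ₗ[R] Q := g ∘ₗ C.mkQ with hh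
  have hB1 : ∀ b ∈ B, h b = b := fun b hb => hg ⟨b, hb⟩
  have hCk : C ≤ LinearMap.ker h := by
    intro t ht
    simp [hh, (Submodule.Quotient.mk_eq_zero C).2 ht]
  have hcom : ∀ N : Submodule R Q, N ⊓ B = ⊥ → N.comap h = C := by
    intro N hN
    refine hCmax _ ?_ (fun t ht => ?_)
    · rw [eq_bot_iff, ← hN]
      rintro t ⟨ht, htB⟩
      exact ⟨by simpa [hB1 t htB] using ht, htB⟩
    · have : h t = 0 := hCk ht
      simp [this]
  have hker : LinearMap.ker h = C := by
    simpa using hcom ⊥ (by simp)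
  have hrange : LinearMap.range h = B := by
    refine hBmax _ (fun N hN hNA => ?_) (fun b hb => ⟨b, hB1 b hb⟩)
    have h1 : N ⊓ B = ⊥ := hB _ inf_le_right (by
      rw [eq_bot_iff, ← hNA]; exact inf_le_inf_right _ inf_le_left)
    have h2 := hcom N h1
    rw [eq_bot_iff]
    intro t ht
    obtain ⟨s, rfl⟩ := hN ht
    have : s ∈ LinearMap.ker h := by rw [hker, ← h2]; exact ht
    simpa using this
  let r : Q →ₗ[R] B := h.codRestrict B (fun t => hrange ▸ ⟨t, rfl⟩)
  refine ⟨ModuleCat.of R B, j.hom.codRestrict B (fun m => hAB ⟨m, rfl⟩), ?_, ⟨?_⟩, ?_⟩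
  · intro a b hab
    exact hj' (congrArg Subtype.val hab)
  · intro X Y _ _ _ _ f hf k
    obtain ⟨l, hl⟩ := hQ'.out f hf (B.subtype ∘ₗ k)
    refine ⟨r ∘ₗ l, fun t => Subtype.ext ?_⟩
    change h (l (f t)) = k t
    rw [hl]
    exact hB1 _ (k t).2
  · intro N hN
    have h1 := hB (N.map B.subtype) (Submodule.map_subtype_le _ _) (by
      rw [eq_bot_iff]
      rintro _ ⟨⟨b, hb, rfl⟩, m, hm⟩
      have : b ∈ N ⊓ LinearMap.range (j.hom.codRestrict B (fun m => hAB ⟨m, rfl⟩)) :=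
        ⟨hb, m, Subtype.ext hm⟩
      rw [hN] at this
      simpa using this)
    exact Submodule.map_injective_of_injective B.injective_subtype (h1.trans (Submodule.map_bot _).symm)

/-- Every module has a minimal injective coresolution. -/
theorem MinimalInjectiveCoresolution.nonempty (R : Type u) [Ring R] (M : Type v) [AddCommGroup M]
    [Module R M] : Nonempty (MinimalInjectiveCoresolution R M) := by
  choose Q i hi hQ he using exists_injective_envelope.{u, v} R
  let M' : ModuleCat.{max u v} R := ModuleCat.of R (ULift.{u} M)
  let step : (Σ X : ModuleCat.{max u v} R, Submodule R X) →
      (Σ X : ModuleCat.{max u v} R, Submodule R X) := fun S =>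
    ⟨Q (ModuleCat.of R (S.1 ⧸ S.2)), LinearMap.range (i (ModuleCat.of R (S.1 ⧸ S.2)))⟩
  let S : ℕ → (Σ X : ModuleCat.{max u v} R, Submodule R X) := fun n =>
    Nat.rec ⟨Q M', LinearMap.range (i M')⟩ (fun _ T => step T) n
  let d : ∀ n, (S n).1 →ₗ[R] (S (n + 1)).1 := fun n =>
    (i (ModuleCat.of R ((S n).1 ⧸ (S n).2))) ∘ₗ (S n).2.mkQ
  let j : M →ₗ[R] (S 0).1 := i M' ∘ₗ (ULift.moduleEquiv (R := R) (M := M)).symm.toLinearMap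
  have hker : ∀ n, LinearMap.ker (d n) = (S n).2 := fun n => by
    rw [LinearMap.ker_comp_of_ker_eq_bot _ (LinearMap.ker_eq_bot.2 (hi _)), Submodule.ker_mkQ]
  have hran : ∀ n, LinearMap.range (d n) = (S (n + 1)).2 := fun n =>
    LinearMap.range_comp_of_range_eq_top _ (Submodule.range_mkQ _)
  have hran0 : LinearMap.range j = (S 0).2 :=
    LinearMap.range_comp_of_range_eq_top _ (LinearEquiv.range _)
  have hess : ∀ n, IsEssentialSubmodule (S n).2 := fun n => by
    cases n with
    | zero => exact he M'
    | succ n => exact he _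
  refine ⟨{ E := fun n => (S n).1, ι := j, d := d, injective := ?_, injective_ι := ?_,
            exact_zero := ?_, exact_succ := ?_, essential_zero := ?_, essential_succ := ?_ }⟩
  · intro n
    cases n with
    | zero => exact hQ M'
    | succ n => exact hQ _
  · exact (hi M').comp (LinearEquiv.injective _)
  · exact LinearMap.exact_iff.2 ((hker 0).trans hran0.symm)
  · exact fun n => LinearMap.exact_iff.2 ((hker (n + 1)).trans (hran n).symm)
  · rw [hran0]; exact hess 0
  · intro n; rw [hran]; exact hess (n + 1)

/-! The key is a local criterion: a module has flat dimension at most `k` as soon as the inclusion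
of each finitely generated submodule factors through some module of flat dimension at most `k`
(`FlatDimLE.of_factors`). Both parts then follow from `MinimalInjectiveCoresolution.flatDimLE`: if
every map from a finitely generated module to `M` factors through one of the modules `M' i`, then
the inclusion of a finitely generated `C ≤ Eⁿ(M)` factors through the `n`-th term of a given, not
necessarily minimal, injective coresolution of some `M' i`.

Let `Z` be the module of cocycles in `C`. Its inclusion represents a class in `Extⁿ(Z, M)`. As `R`
is Noetherian, dimension shifting shows that this class comes from some `Extⁿ(Z, M' i)`
(`BaerCoresolution.exists_approximation`), say from `g' : Z → Eⁿ(M' i)`. For `n > 0` the inclusion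
equals a coboundary `d t` on `ker g'`, so `t (ker g')` meets the cocycles of `Eⁿ⁻¹(M)` trivially and
vanishes by minimality; hence `g'` is injective. For `n = 0` this is immediate. Extend `g'` to `C`:
the extension is injective because the cocycles are essential. Injectivity of `Eⁿ(M)` gives the map
back.

For a direct limit, the `M' i` are its terms. For a flat module they are the free modules `Rᵐ`, by
the Lazard-type lemma `IsFlatModule.exists_factorization`, and `Eⁿ(R)ᵐ` serves as the `n`-th term.
Flatness itself is handled as injectivity of the character module. -/

/-! ### Character modules over noncommutative rings -/

/-- The character module `Hom_ℤ(X, ℚ/ℤ)` of a left `R`-module `X`, as a right `R`-module. -/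
def CharDual (R : Type u) [Ring R] (X : Type v) [AddCommGroup X] [Module R X] : Type v :=
  X →+ AddCircle (1 : ℚ)

namespace CharDual

variable {R : Type u} [Ring R] {X : Type v} [AddCommGroup X] [Module R X]
  {Y : Type w} [AddCommGroup Y] [Module R Y] {Z : Type x} [AddCommGroup Z] [Module R Z]

instance : AddCommGroup (CharDual R X) := inferInstanceAs (AddCommGroup (X →+ AddCircle (1 : ℚ)))

instance : FunLike (CharDual R X) X (AddCircle (1 : ℚ)) :=
  inferInstanceAs (FunLike (X →+ AddCircle (1 : ℚ)) X (AddCircle (1 : ℚ)))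

instance : AddMonoidHomClass (CharDual R X) X (AddCircle (1 : ℚ)) :=
  inferInstanceAs (AddMonoidHomClass (X →+ AddCircle (1 : ℚ)) X (AddCircle (1 : ℚ)))

@[ext] theorem ext {c c' : CharDual R X} (h : ∀ x, c x = c' x) : c = c' := DFunLike.ext _ _ h

@[simp] theorem add_apply (c c' : CharDual R X) (x : X) : (c + c') x = c x + c' x := rfl

@[simp] theorem zero_apply (x : X) : (0 : CharDual R X) x = 0 := rfl

instance : SMul Rᵐᵒᵖ (CharDual R X) :=
  ⟨fun r c => (c : X →+ AddCircle (1 : ℚ)).comp (DistribSMul.toAddMonoidHom X r.unop)⟩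

@[simp] theorem smul_apply (r : Rᵐᵒᵖ) (c : CharDual R X) (x : X) : (r • c) x = c (r.unop • x) := rfl

instance : Module Rᵐᵒᵖ (CharDual R X) where
  one_smul c := by ext x; simp
  mul_smul a b c := by ext x; simp [mul_smul]
  smul_zero a := by ext x; simp
  smul_add a c c' := by ext x; simp
  add_smul a b c := by ext x; simp [add_smul]
  zero_smul c := by ext x; simp

/-- Precomposition with a linear map, on character modules. -/
def dual (f : X →ₗ[R] Y) : CharDual R Y →ₗ[Rᵐᵒᵖ] CharDual R X where
  toFun c := (c : Y →+ AddCircle (1 : ℚ)).comp f.toAddMonoidHom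
  map_add' _ _ := rfl
  map_smul' r c := by
    ext x
    change c (r.unop • f x) = c (f (r.unop • x))
    rw [f.map_smul]

@[simp] theorem dual_apply (f : X →ₗ[R] Y) (c : CharDual R Y) (x : X) : dual f c x = c (f x) := rfl

theorem exists_comp_eq {A : Type x} {B : Type y} [AddCommGroup A] [AddCommGroup B] (i : A →+ B)
    (hi : Function.Injective i) (f : A →+ AddCircle (1 : ℚ)) :
    ∃ g : B →+ AddCircle (1 : ℚ), ∀ a, g (i a) = f a := by
  obtain ⟨g, hg⟩ := (Module.Baer.of_divisible _).extension_property_addMonoidHom i hi f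
  exact ⟨g, fun a => DFunLike.congr_fun hg a⟩

/-- A homomorphism to `ℚ/ℤ` vanishing on the kernel of `i` factors through `i`. -/
theorem exists_comp_eq_of_ker {A : Type x} {B : Type y} [AddCommGroup A] [AddCommGroup B]
    (i : A →+ B) (f : A →+ AddCircle (1 : ℚ)) (h : ∀ a, i a = 0 → f a = 0) :
    ∃ g : B →+ AddCircle (1 : ℚ), ∀ a, g (i a) = f a := by
  obtain ⟨g, hg⟩ := exists_comp_eq (QuotientAddGroup.kerLift i)
    (QuotientAddGroup.kerLift_injective i) (QuotientAddGroup.lift i.ker f h)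
  exact ⟨g, fun a => hg (a : A ⧸ i.ker)⟩

theorem exists_ne_zero {A : Type x} [AddCommGroup A] (S : AddSubgroup A) (a : A) (ha : a ∉ S) :
    ∃ g : A →+ AddCircle (1 : ℚ), (∀ s ∈ S, g s = 0) ∧ g a ≠ 0 := by
  obtain ⟨c, hc⟩ := CharacterModule.exists_character_apply_ne_zero_of_ne_zero
    (a := (a : A ⧸ S)) (by simpa using ha)
  refine ⟨AddMonoidHom.comp c (QuotientAddGroup.mk' S), fun s hs => ?_, hc⟩
  have : QuotientAddGroup.mk' S s = 0 := (QuotientAddGroup.eq_zero_iff s).2 hs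
  exact (congrArg c this).trans (map_zero c)

theorem dual_injective {f : X →ₗ[R] Y} (hf : Function.Surjective f) :
    Function.Injective (dual f) := by
  intro c c' h
  ext y
  obtain ⟨x, rfl⟩ := hf y
  exact DFunLike.congr_fun h x

theorem dual_surjective {f : X →ₗ[R] Y} (hf : Function.Injective f) :
    Function.Surjective (dual f) := by
  intro c
  obtain ⟨g, hg⟩ := exists_comp_eq f.toAddMonoidHom hf c
  exact ⟨g, CharDual.ext hg⟩

theorem dual_exact {f : X →ₗ[R] Y} {g : Y →ₗ[R] Z} (h : Function.Exact f g) :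
    Function.Exact (dual g) (dual f) := by
  intro c
  constructor
  · intro hc
    obtain ⟨c', hc'⟩ := exists_comp_eq_of_ker g.toAddMonoidHom c (by
      intro y hy
      obtain ⟨x, rfl⟩ := (h y).1 hy
      exact DFunLike.congr_fun hc x)
    exact ⟨c', CharDual.ext hc'⟩
  · rintro ⟨c, rfl⟩
    ext x
    simp [h.apply_apply_eq_zero]

/-- The homomorphism `N ⊗_R X → ℚ/ℤ` defined by a homomorphism from `N` to the character module. -/
noncomputable def uncurry {N : Type w} [AddCommGroup N] [Module Rᵐᵒᵖ N]
    (φ : N →ₗ[Rᵐᵒᵖ] CharDual R X) : BalancedTensor R N X →+ AddCircle (1 : ℚ) :=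
  QuotientAddGroup.lift _
    (TensorProduct.liftAddHom (R := ℤ) (M := N) (N := X)
      (φ.toAddMonoidHom : N →+ (X →+ AddCircle (1 : ℚ)))
      (fun r n x => by
        change φ (r • n) x = φ n (r • x)
        rw [map_zsmul (φ n), map_zsmul φ]
        rfl)) (by
    refine (AddSubgroup.closure_le _).2 ?_
    rintro _ ⟨n, r, x, rfl⟩
    change _ = _
    rw [map_sub, sub_eq_zero]
    change φ (MulOpposite.op r • n) x = φ n (r • x)
    rw [map_smul]
    rfl)

/-- The homomorphism from `N` to the character module defined by `N ⊗_R X → ℚ/ℤ`. -/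
noncomputable def curry {N : Type w} [AddCommGroup N] [Module Rᵐᵒᵖ N]
    (g : BalancedTensor R N X →+ AddCircle (1 : ℚ)) : N →ₗ[Rᵐᵒᵖ] CharDual R X where
  toFun n := (g.comp (QuotientAddGroup.mk' _)).comp (TensorProduct.mk ℤ N X n).toAddMonoidHom
  map_add' n n' := by
    ext x
    change g (QuotientAddGroup.mk ((n + n') ⊗ₜ[ℤ] x)) =
      g (QuotientAddGroup.mk (n ⊗ₜ[ℤ] x)) + g (QuotientAddGroup.mk (n' ⊗ₜ[ℤ] x))
    rw [TensorProduct.add_tmul, QuotientAddGroup.mk_add, map_add]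
  map_smul' r n := by
    ext x
    change g (QuotientAddGroup.mk ((r • n) ⊗ₜ[ℤ] x)) =
      g (QuotientAddGroup.mk (n ⊗ₜ[ℤ] (r.unop • x)))
    congr 1
    rw [← sub_eq_zero, ← QuotientAddGroup.mk_sub, QuotientAddGroup.eq_zero_iff]
    exact AddSubgroup.subset_closure ⟨n, r.unop, x, rfl⟩

theorem uncurry_curry {N : Type w} [AddCommGroup N] [Module Rᵐᵒᵖ N]
    (g : BalancedTensor R N X →+ AddCircle (1 : ℚ)) : uncurry (curry g) = g := by
  ext t
  induction t using TensorProduct.induction_on with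
  | zero => simp
  | tmul n x => rfl
  | add a b ha hb => rw [map_add, map_add, ha, hb]

theorem uncurry_map {N : Type w} [AddCommGroup N] [Module Rᵐᵒᵖ N] {N' : Type y} [AddCommGroup N']
    [Module Rᵐᵒᵖ N'] (f : N →ₗ[Rᵐᵒᵖ] N') (φ : N' →ₗ[Rᵐᵒᵖ] CharDual R X)
    (t : BalancedTensor R N X) :
    uncurry φ (BalancedTensor.map f X t) = uncurry (φ ∘ₗ f) t := by
  obtain ⟨t, rfl⟩ := QuotientAddGroup.mk_surjective t
  induction t using TensorProduct.induction_on with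
  | zero => simp
  | tmul n x => rfl
  | add a b ha hb => rw [QuotientAddGroup.mk_add, map_add, map_add, map_add, ha, hb]

end CharDual

/-! ### Flatness and character modules -/

/-- A left module is flat if and only if its character module is injective. -/
theorem isFlatModule_iff_baer (R : Type u) [Ring R] (X : Type v) [AddCommGroup X] [Module R X] :
    IsFlatModule R X ↔ Module.Baer Rᵐᵒᵖ (CharDual R X) := by
  constructor
  · intro h J φ
    have hJ := h (N := J) (N' := Rᵐᵒᵖ) J.subtype J.injective_subtype
    -- Flatness embeds `J ⊗ X` in `Rᵐᵒᵖ ⊗ X`, so the character corresponding to `φ` extends;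
    -- currying it back extends `φ`.
    obtain ⟨g, hg⟩ := CharDual.exists_comp_eq _ hJ (CharDual.uncurry φ)
    refine ⟨CharDual.curry g, fun r hr => CharDual.ext fun x => ?_⟩
    exact hg (QuotientAddGroup.mk ((⟨r, hr⟩ : J) ⊗ₜ[ℤ] x))
  · intro h N N' _ _ _ _ f hf
    rw [injective_iff_map_eq_zero]
    intro t ht
    by_contra hne
    obtain ⟨g, -, hg⟩ := CharDual.exists_ne_zero ⊥ t (by simpa using hne)
    obtain ⟨φ, hφ⟩ := h.extension_property f hf (CharDual.curry g)
    apply hg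
    rw [← CharDual.uncurry_curry g, ← hφ, ← CharDual.uncurry_map, ht, map_zero]

/-- The map `φ` extends to `g` on all of `Rᵐᵒᵖ`, and then `φ r x` is the single character `g 1`
evaluated at `r • x`. -/
theorem IsFlatModule.sum_eq_zero {R : Type u} [Ring R] {X : Type v} [AddCommGroup X] [Module R X]
    (h : IsFlatModule R X) (J : Ideal Rᵐᵒᵖ) (φ : J →ₗ[Rᵐᵒᵖ] CharDual R X) {ι : Type w}
    (s : Finset ι) (r : ι → J) (x : ι → X) (hs : ∑ i ∈ s, (r i).1.unop • x i = 0) :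
    ∑ i ∈ s, φ (r i) (x i) = 0 := by
  obtain ⟨g, hg⟩ := (isFlatModule_iff_baer R X).1 h J φ
  have h1 : ∀ i, φ (r i) (x i) = g 1 ((r i).1.unop • x i) := by
    intro i
    rw [← CharDual.smul_apply, ← map_smul, smul_eq_mul, mul_one, hg (r i).1 (r i).2]
  simp only [h1]
  rw [← map_sum, hs, map_zero]

/-- A left module is flat if every homomorphism from a right ideal to its character module
respects all linear relations with coefficients in the ideal. -/
theorem IsFlatModule.of_relations {R : Type u} [Ring R] {X : Type v} [AddCommGroup X] [Module R X]
    (h : ∀ (J : Ideal Rᵐᵒᵖ) (φ : J →ₗ[Rᵐᵒᵖ] CharDual R X) (s : Finset (J × X)),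
      ∑ p ∈ s, p.1.1.unop • p.2 = 0 → ∑ p ∈ s, φ p.1 p.2 = 0) : IsFlatModule R X := by
  rw [isFlatModule_iff_baer]
  intro J φ
  let m : J ⊗[ℤ] X →+ X := TensorProduct.liftAddHom (R := ℤ) (M := J) (N := X)
    { toFun := fun r => DistribSMul.toAddMonoidHom X r.1.unop
      map_zero' := by ext x; simp
      map_add' := fun a b => by ext x; simp [add_smul] }
    (fun n r x => by
      change (n • r.1.unop) • x = r.1.unop • (n • x)
      rw [smul_comm r.1.unop n x, smul_assoc])
  -- By hypothesis `ψ` kills the kernel of the multiplication `m`, so it is induced by a character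
  -- `χ` of `X`; then `r ↦ r • χ` extends `φ`.
  let ψ : J ⊗[ℤ] X →+ AddCircle (1 : ℚ) := (CharDual.uncurry φ).comp (QuotientAddGroup.mk' _)
  obtain ⟨χ, hχ⟩ := CharDual.exists_comp_eq_of_ker m ψ (by
    intro t ht
    obtain ⟨s, rfl⟩ := TensorProduct.exists_finset t
    rw [map_sum] at ht ⊢
    exact h J φ s ht)
  refine ⟨LinearMap.toSpanSingleton Rᵐᵒᵖ (CharDual R X) χ, fun r hr => CharDual.ext fun x => ?_⟩
  exact hχ ((⟨r, hr⟩ : J) ⊗ₜ[ℤ] x)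

/-! ### Flat modules -/

section Flat

variable {R : Type u} [Ring R]

/-- A module is flat if the inclusion of each finitely generated submodule factors through a flat
module. -/
theorem IsFlatModule.of_factors {X : Type v} [AddCommGroup X] [Module R X]
    (h : ∀ C : Submodule R X, C.FG → ∃ (D : Type w) (_ : AddCommGroup D) (_ : Module R D)
      (a : C →ₗ[R] D) (b : D →ₗ[R] X), IsFlatModule R D ∧ ∀ c, b (a c) = c) :
    IsFlatModule R X := by
  classical
  refine .of_relations fun J φ s hs => ?_
  obtain ⟨D, _, _, a, b, hD, hab⟩ := h (Submodule.span R (s.image Prod.snd : Finset X)) ⟨_, rfl⟩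
  let e : s → Submodule.span R ((s.image Prod.snd : Finset X) : Set X) := fun p =>
    ⟨p.1.2, Submodule.subset_span (Finset.mem_coe.2 (Finset.mem_image_of_mem _ p.2))⟩
  have h1 : ∑ p ∈ s.attach, p.1.1.1.unop • e p = 0 := by
    apply Subtype.ext
    rw [← Finset.sum_attach] at hs
    simpa [e] using hs
  have h2 := hD.sum_eq_zero J (CharDual.dual b ∘ₗ φ) s.attach (fun p => p.1.1) (fun p => a (e p)) (by
    simpa using congrArg a h1)
  rw [← Finset.sum_attach, ← h2]
  refine Finset.sum_congr rfl fun p _ => ?_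
  simp [hab, e]

theorem IsFlatModule.of_equiv {X : Type v} [AddCommGroup X] [Module R X] {Y : Type w}
    [AddCommGroup Y] [Module R Y] (e : X ≃ₗ[R] Y) (h : IsFlatModule R X) : IsFlatModule R Y :=
  .of_factors fun C _ => ⟨X, _, _, e.symm.toLinearMap ∘ₗ C.subtype, e.toLinearMap, h, by simp⟩

/-- Coefficients can be moved across: `φ r x` is the value at `1` of `φ (r * x)`, which turns a
relation into `φ 0 = 0`. -/
theorem isFlatModule_self : IsFlatModule R R := by
  refine .of_relations fun J φ s hs => ?_
  have h1 : ∀ p : J × R, φ p.1 p.2 = φ (MulOpposite.op p.2 • p.1) 1 := by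
    intro p
    simp
  have h2 : ∑ p ∈ s, MulOpposite.op p.2 • p.1 = 0 := by
    apply Subtype.ext
    apply MulOpposite.unop_injective
    simpa using hs
  simp only [h1]
  have h3 : ∀ t : Finset (J × R), ∑ p ∈ t, φ (MulOpposite.op p.2 • p.1) 1 =
      φ (∑ p ∈ t, MulOpposite.op p.2 • p.1) 1 := by
    classical
    intro t
    induction t using Finset.induction_on with
    | empty => simp
    | insert a t ha ih => rw [Finset.sum_insert ha, Finset.sum_insert ha, ih, map_add]; rfl
  rw [h3, h2, map_zero]
  rfl

theorem IsFlatModule.finsupp {X : Type v} [AddCommGroup X] [Module R X] (h : IsFlatModule R X)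
    (ι : Type w) : IsFlatModule R (ι →₀ X) := by
  classical
  refine .of_relations fun J φ s hs => ?_
  let t : Finset ι := s.biUnion fun p => p.2.support
  have h1 : ∀ p ∈ s, φ p.1 p.2 = ∑ j ∈ t, (CharDual.dual (Finsupp.lsingle j) ∘ₗ φ) p.1 (p.2 j) := by
    intro p hp
    have h2 : p.2 = ∑ j ∈ t, Finsupp.single j (p.2 j) := by
      conv_lhs => rw [← Finsupp.sum_single p.2]
      exact Finset.sum_subset (Finset.subset_biUnion_of_mem (fun p : J × (ι →₀ X) => p.2.support) hp)
        (fun j _ hj => by simp [Finsupp.notMem_support_iff.1 hj])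
    conv_lhs => rw [h2, map_sum]
    rfl
  rw [Finset.sum_congr rfl h1, Finset.sum_comm]
  refine Finset.sum_eq_zero fun j _ => ?_
  refine h.sum_eq_zero J _ s (fun p => p.1) (fun p => p.2 j) ?_
  simpa [Finsupp.finsetSum_apply] using DFunLike.congr_fun hs j

theorem IsFlatModule.pi {X : Type v} [AddCommGroup X] [Module R X] (h : IsFlatModule R X)
    (ι : Type w) [Finite ι] : IsFlatModule R (ι → X) :=
  .of_equiv (Finsupp.linearEquivFunOnFinite R X ι) (h.finsupp ι)

theorem isFlatModule_of_subsingleton (X : Type v) [AddCommGroup X] [Module R X] [Subsingleton X] :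
    IsFlatModule R X :=
  .of_relations fun J φ s _ => Finset.sum_eq_zero fun p _ => by
    rw [Subsingleton.elim p.2 0, map_zero]

/-- Linear relations in a flat module are consequences of linear relations in the ring: a
homomorphism from a finitely presented module to a flat module factors through a finitely
generated free module. -/
theorem IsFlatModule.exists_factorization {F : Type v} [AddCommGroup F] [Module R F]
    (hF : IsFlatModule R F) {K : Type w} [AddCommGroup K] [Module R K]
    {a : ℕ} (π : (Fin a → R) →ₗ[R] K) (hπ : Function.Surjective π)
    (hker : (LinearMap.ker π).FG) (φ : K →ₗ[R] F) :
    ∃ (m : ℕ) (p : K →ₗ[R] (Fin m → R)) (q : (Fin m → R) →ₗ[R] F), q ∘ₗ p = φ := by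
  classical
  obtain ⟨rel, hrel⟩ := hker
  let x : Fin a → F := fun j => φ (π (Pi.single j 1))
  have hx : ∀ c : Fin a → R, φ (π c) = ∑ j, c j • x j := by
    intro c
    conv_lhs => rw [pi_eq_sum_univ' c]
    simp [x]
  -- `ρ` multiplies the column of unknown coefficients by the matrix of relations.
  let ρ : (Fin a → Rᵐᵒᵖ) →ₗ[Rᵐᵒᵖ] (rel → Rᵐᵒᵖ) :=
    { toFun := fun c l => ∑ j, c j * MulOpposite.op (l.1 j)
      map_add' := fun c c' => by ext l; simp [add_mul, Finset.sum_add_distrib]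
      map_smul' := fun r c => by
        funext l
        simp [Finset.mul_sum, mul_assoc] }
  -- `S` is generated by the solutions of the relations in `R`, multiplied by elements of `F`. That
  -- `x` lies in `S` is the equational criterion for flatness.
  let S : AddSubgroup (Fin a → F) := AddSubgroup.closure
    {z | ∃ (c : Fin a → Rᵐᵒᵖ) (y : F), ρ c = 0 ∧ z = fun j => (c j).unop • y}
  have hmem : x ∈ S := by
    by_contra hxS
    obtain ⟨χ, hχS, hχx⟩ := CharDual.exists_ne_zero S x hxS
    let θ : (Fin a → Rᵐᵒᵖ) →ₗ[Rᵐᵒᵖ] CharDual R F :=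
      { toFun := fun c => χ.comp
          { toFun := fun y j => (c j).unop • y
            map_zero' := by ext; simp
            map_add' := fun y y' => by ext; simp }
        map_add' := fun c c' => by
          ext y
          change χ (fun j => (c j + c' j).unop • y) =
            χ (fun j => (c j).unop • y) + χ (fun j => (c' j).unop • y)
          rw [← map_add]
          congr 1
          ext j
          simp [add_smul]
        map_smul' := fun r c => by
          ext y
          change χ (fun j => (r • c j).unop • y) = χ (fun j => (c j).unop • (r.unop • y))
          simp [mul_smul] }
    have hθ : ∀ c y, θ c y = χ (fun j => (c j).unop • y) := fun _ _ => rfl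
    -- Since `χ` kills `S`, `θ` kills `ker ρ` and so lives on the image of `ρ`; injectivity of the
    -- character module extends it to `g`.
    obtain ⟨g, hg⟩ := ((isFlatModule_iff_baer R F).1 hF).extension_property
      ((LinearMap.ker ρ).liftQ ρ le_rfl) (by
        rw [← LinearMap.ker_eq_bot]
        exact Submodule.ker_liftQ_eq_bot _ _ _ le_rfl)
      ((LinearMap.ker ρ).liftQ θ (fun c hc => CharDual.ext fun y =>
        hχS _ (AddSubgroup.subset_closure ⟨c, y, hc, rfl⟩)))
    have hg' : ∀ c, g (ρ c) = θ c := fun c => LinearMap.congr_fun hg (Submodule.Quotient.mk c)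
    apply hχx
    have h1 : χ x = ∑ j, θ (Pi.single j 1) (x j) := by
      simp only [hθ]
      rw [← map_sum]
      congr 1
      ext j
      rw [Finset.sum_apply, Finset.sum_eq_single j]
      · simp
      · intro i _ hij
        simp [Pi.single_eq_of_ne hij.symm]
      · simp
    have h2 : ∀ j, θ (Pi.single j 1) (x j) = ∑ l : rel, g (Pi.single l 1) (l.1 j • x j) := by
      intro j
      have h3 : ρ (Pi.single j 1) = ∑ l : rel, MulOpposite.op (l.1 j) • Pi.single l 1 := by
        ext l
        simp [ρ, Finset.sum_apply, Pi.single_apply]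
      have h4 : ∀ (t : Finset rel), g (∑ l ∈ t, MulOpposite.op (l.1 j) • Pi.single l 1) (x j) =
          ∑ l ∈ t, g (Pi.single l 1) (l.1 j • x j) := by
        intro t
        induction t using Finset.induction_on with
        | empty => simp
        | insert l t hl ih =>
          rw [Finset.sum_insert hl, Finset.sum_insert hl, map_add, CharDual.add_apply, ih, map_smul]
          rfl
      rw [← hg', h3, h4]
    -- Summing over `j` first gives, for each relation `l`, the character `g (Pi.single l 1)` at `∑
    -- j, l j • x j = φ (π l) = 0`.
    rw [h1, Finset.sum_congr rfl fun j _ => h2 j, Finset.sum_comm]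
    refine Finset.sum_eq_zero fun l _ => ?_
    rw [← map_sum, ← hx]
    have : l.1 ∈ LinearMap.ker π := hrel ▸ Submodule.subset_span l.2
    rw [LinearMap.mem_ker.1 this, map_zero, map_zero]
  have hS : ∀ z ∈ S, ∃ (m : ℕ) (c : Fin m → Fin a → Rᵐᵒᵖ) (y : Fin m → F),
      (∀ k, ρ (c k) = 0) ∧ ∀ j, z j = ∑ k, (c k j).unop • y k := by
    intro z hz
    induction hz using AddSubgroup.closure_induction with
    | mem z hz =>
      obtain ⟨c, y, hc, rfl⟩ := hz
      exact ⟨1, fun _ => c, fun _ => y, fun _ => hc, fun j => by simp⟩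
    | zero => exact ⟨0, Fin.elim0, Fin.elim0, fun k => k.elim0, fun j => by simp⟩
    | add z z' _ _ hz hz' =>
      obtain ⟨m, c, y, hc, h⟩ := hz
      obtain ⟨m', c', y', hc', h'⟩ := hz'
      refine ⟨m + m', Fin.append c c', Fin.append y y', fun k => ?_, fun j => ?_⟩
      · induction k using Fin.addCases with
        | left k => simpa using hc k
        | right k => simpa using hc' k
      · simp [Fin.sum_univ_add, h, h']
    | neg z _ hz =>
      obtain ⟨m, c, y, hc, h⟩ := hz
      exact ⟨m, c, fun k => - y k, hc, fun j => by simp [h]⟩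
  obtain ⟨m, c, y, hc, hcy⟩ := hS x hmem
  -- The coefficients expressing `x` through `y` give `p₀`; each `c k` solves the relations, so `p₀`
  -- descends to `K`.
  let p₀ : (Fin a → R) →ₗ[R] (Fin m → R) :=
    { toFun := fun b k => ∑ j, b j * (c k j).unop
      map_add' := fun b b' => by ext k; simp [add_mul, Finset.sum_add_distrib]
      map_smul' := fun r b => by ext k; simp [Finset.mul_sum, mul_assoc] }
  let q : (Fin m → R) →ₗ[R] F := Fintype.linearCombination R y
  have hp₀ : LinearMap.ker π ≤ LinearMap.ker p₀ := by
    rw [← hrel, Submodule.span_le]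
    intro l hl
    refine LinearMap.mem_ker.2 (funext fun k => ?_)
    have := congrArg MulOpposite.unop (congrFun (hc k) ⟨l, hl⟩)
    simpa [ρ, p₀] using this
  have hqp : ∀ b, q (p₀ b) = φ (π b) := by
    intro b
    rw [hx]
    simp only [q, p₀, Fintype.linearCombination_apply, hcy, LinearMap.coe_mk, AddHom.coe_mk,
      Finset.sum_smul, Finset.smul_sum, mul_smul]
    exact Finset.sum_comm
  refine ⟨m, (LinearMap.ker π).liftQ p₀ hp₀ ∘ₗ
    (π.quotKerEquivOfSurjective hπ).symm.toLinearMap, q, LinearMap.ext fun z => ?_⟩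
  obtain ⟨b, rfl⟩ := hπ z
  have : (π.quotKerEquivOfSurjective hπ).symm (π b) = Submodule.Quotient.mk b := by
    rw [LinearEquiv.symm_apply_eq]
    rfl
  simp [this, hqp]

end Flat

/-! ### Flat dimension by functorial free resolutions -/

section FlatDimension

/-- The kernel of the canonical homomorphism from the free module on the set `X` to `X`. -/
noncomputable abbrev freeSyzygy (R : Type u) [Ring R] (X : Type v) [AddCommGroup X] [Module R X] :
    Submodule R (X →₀ R) :=
  LinearMap.ker (Finsupp.linearCombination R (id : X → X))

/-- The `k`-th syzygy in the functorial free resolution of `X` is flat. -/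
def FlatDimLE (R : Type u) [Ring R] :
    ℕ → ∀ (X : Type (max u v)) [AddCommGroup X] [Module R X], Prop
  | 0, X, _, _ => IsFlatModule R X
  | k + 1, X, _, _ => FlatDimLE R k (freeSyzygy R X)

variable {R : Type u} [Ring R]

theorem linearCombination_mapDomain_id {X : Type v} [AddCommGroup X] [Module R X] {Y : Type w}
    [AddCommGroup Y] [Module R Y] (f : X →ₗ[R] Y) (c : X →₀ R) :
    Finsupp.linearCombination R (id : Y → Y) (Finsupp.mapDomain f c) =
      f (Finsupp.linearCombination R (id : X → X) c) := by
  rw [Finsupp.linearCombination_mapDomain, Function.id_comp,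
    Finsupp.apply_linearCombination R f id c, Function.comp_id]

/-- The homomorphism of syzygies induced by a homomorphism of modules. -/
noncomputable def freeSyzygyMap {X : Type v} [AddCommGroup X] [Module R X] {Y : Type w}
    [AddCommGroup Y] [Module R Y] (f : X →ₗ[R] Y) : freeSyzygy R X →ₗ[R] freeSyzygy R Y :=
  (Finsupp.lmapDomain R R f).restrict fun c hc => by
    rw [LinearMap.mem_ker, Finsupp.lmapDomain_apply, linearCombination_mapDomain_id,
      LinearMap.mem_ker.1 hc, map_zero]

@[simp] theorem freeSyzygyMap_coe {X : Type v} [AddCommGroup X] [Module R X] {Y : Type w}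
    [AddCommGroup Y] [Module R Y] (f : X →ₗ[R] Y) (c : freeSyzygy R X) :
    (freeSyzygyMap f c : Y →₀ R) = Finsupp.mapDomain f c.1 := rfl

/-- A finitely generated submodule of the syzygy of `X` comes from the syzygy of a finitely
generated submodule of `X`. -/
theorem exists_freeSyzygy_lift {X : Type v} [AddCommGroup X] [Module R X]
    (C : Submodule R (freeSyzygy R X)) (hC : C.FG) :
    ∃ (S : Submodule R X) (l : C →ₗ[R] freeSyzygy R S), S.FG ∧
      ∀ c, freeSyzygyMap S.subtype (l c) = c := by
  classical
  obtain ⟨T, rfl⟩ := hC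
  -- `S` is spanned by all elements of `X` occurring in the supports of the generators.
  let s : Finset X := T.biUnion fun c => c.1.support
  let S : Submodule R X := Submodule.span R s
  have hsupp : ∀ c ∈ Submodule.span R (T : Set (freeSyzygy R X)),
      c.1 ∈ Finsupp.supported R R (S : Set X) := by
    intro c hc
    have : Submodule.span R (T : Set (freeSyzygy R X)) ≤
        (Finsupp.supported R R (S : Set X)).comap (freeSyzygy R X).subtype := by
      rw [Submodule.span_le]
      intro t ht
      refine fun z hz => Submodule.subset_span (Finset.mem_coe.2 (Finset.mem_biUnion.2 ⟨t, ht, hz⟩))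
    exact this hc
  have hval : ∀ c ∈ Submodule.span R (T : Set (freeSyzygy R X)),
      Finsupp.mapDomain S.subtype (c.1.subtypeDomain (· ∈ S)) = c.1 := by
    intro c hc
    have h1 := hsupp c hc
    ext z
    by_cases hz : z ∈ S
    · exact Finsupp.mapDomain_apply S.injective_subtype _ (⟨z, hz⟩ : S)
    · rw [Finsupp.mapDomain_of_notMem_range _ _ (by simpa using hz)]
      by_contra hne
      exact hz (h1 (Finset.mem_coe.2 (Finsupp.mem_support_iff.2 fun h => hne h.symm)))
  let l₀ : Submodule.span R (T : Set (freeSyzygy R X)) →ₗ[R] (S →₀ R) :=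
    Finsupp.lsubtypeDomain (S : Set X) ∘ₗ (freeSyzygy R X).subtype ∘ₗ Submodule.subtype _
  have hl₀ : ∀ c, Finsupp.mapDomain S.subtype (l₀ c) = c.1.1 := fun c => hval c.1 c.2
  refine ⟨S, l₀.codRestrict _ fun c => ?_, ⟨s, rfl⟩, fun c => Subtype.ext (hl₀ c)⟩
  rw [LinearMap.mem_ker]
  apply S.injective_subtype
  rw [← linearCombination_mapDomain_id, hl₀, map_zero]
  exact c.1.2

/-- A finitely generated part of the syzygy of `X` lifts to the syzygy of a finitely generated `S ≤
X`, and functoriality of `freeSyzygy` carries a factorization of `S → X` through `D` to one through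
the syzygy of `D`. This is why the functorial resolution is used. -/
theorem FlatDimLE.of_factors (k : ℕ) : ∀ {X : Type (max u v)} [AddCommGroup X] [Module R X],
    (∀ C : Submodule R X, C.FG → ∃ (D : Type (max u w)) (_ : AddCommGroup D) (_ : Module R D)
      (a : C →ₗ[R] D) (b : D →ₗ[R] X), FlatDimLE.{u, w} R k D ∧ ∀ c, b (a c) = c) →
    FlatDimLE.{u, v} R k X := by
  induction k with
  | zero =>
    intro X _ _ h
    exact IsFlatModule.of_factors h
  | succ k ih =>
    intro X _ _ h
    refine ih (X := freeSyzygy R X) fun C hC => ?_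
    obtain ⟨S, l, hS, hl⟩ := exists_freeSyzygy_lift C hC
    obtain ⟨D, _, _, a, b, hD, hab⟩ := h S hS
    refine ⟨freeSyzygy R D, _, _, freeSyzygyMap a ∘ₗ l, freeSyzygyMap b, hD, fun c => ?_⟩
    rw [← hl c]
    apply Subtype.ext
    simp only [LinearMap.comp_apply, freeSyzygyMap_coe, ← Finsupp.mapDomain_comp]
    congr 1
    exact funext hab

theorem linearCombination_id_surjective (X : Type v) [AddCommGroup X] [Module R X] :
    Function.Surjective (Finsupp.linearCombination R (id : X → X)) :=
  fun z => ⟨Finsupp.single z 1, by simp⟩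

/-- Extend a flat resolution of the kernel of a surjection from a flat module. -/
theorem FlatResolution.exists_cons {X F : Type (max u v)} [AddCommGroup X] [Module R X]
    [AddCommGroup F] [Module R F] (hF : IsFlatModule R F) (f : F →ₗ[R] X)
    (hf : Function.Surjective f) {k : ℕ} (P : FlatResolution.{u, max u v} R (LinearMap.ker f))
    (hP : ∀ i, k < i → Subsingleton (P.F i)) :
    ∃ Q : FlatResolution.{u, max u v} R X, ∀ i, k + 1 < i → Subsingleton (Q.F i) := by
  let G : ℕ → ModuleCat.{max u v} R := fun i => match i with
    | 0 => ModuleCat.of R F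
    | i + 1 => ModuleCat.of R (P.F i)
  let d : ∀ i, G (i + 1) →ₗ[R] G i := fun i => match i with
    | 0 => (LinearMap.ker f).subtype ∘ₗ P.ε
    | i + 1 => P.d i
  refine ⟨{ F := fun i => G i, ε := f, d := d, flat := ?_, surjective_ε := hf, exact_zero := ?_,
            exact_succ := ?_ }, ?_⟩
  · rintro (_ | i)
    · exact hF
    · exact P.flat i
  · intro z
    constructor
    · intro hz
      obtain ⟨t, ht⟩ := P.surjective_ε ⟨z, hz⟩
      exact ⟨t, congrArg Subtype.val ht⟩
    · rintro ⟨t, rfl⟩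
      exact (P.ε t).2
  · rintro (_ | i)
    · intro z
      refine Iff.trans ?_ (P.exact_zero z)
      exact Submodule.coe_eq_zero
    · exact P.exact_succ i
  · rintro (_ | i) hi
    · omega
    · exact hP i (by omega)

/-- Truncate a flat resolution. -/
theorem FlatResolution.exists_tail {X : Type (max u v)} [AddCommGroup X] [Module R X] {k : ℕ}
    (P : FlatResolution.{u, max u v} R X) (hP : ∀ i, k + 1 < i → Subsingleton (P.F i)) :
    ∃ Q : FlatResolution.{u, max u v} R (LinearMap.ker P.ε),
      ∀ i, k < i → Subsingleton (Q.F i) := by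
  refine ⟨{ F := fun i => P.F (i + 1), d := fun i => P.d (i + 1), flat := fun i => P.flat (i + 1),
            ε := (P.d 0).codRestrict _ fun z => P.exact_zero.apply_apply_eq_zero z,
            surjective_ε := ?_, exact_zero := ?_,
            exact_succ := fun i => P.exact_succ (i + 1) }, fun i hi => hP (i + 1) (by omega)⟩
  · rintro ⟨z, hz⟩
    obtain ⟨t, ht⟩ := (P.exact_zero z).1 hz
    exact ⟨t, Subtype.ext ht⟩
  · intro z
    refine Iff.trans ?_ (P.exact_succ 0 z)
    exact Submodule.coe_eq_zero.symm

theorem FlatDimLE.exists_resolution (k : ℕ) : ∀ {X : Type (max u v)} [AddCommGroup X] [Module R X],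
    FlatDimLE.{u, v} R k X →
    ∃ P : FlatResolution.{u, max u v} R X, ∀ i, k < i → Subsingleton (P.F i) := by
  induction k with
  | zero =>
    intro X _ _ h
    let G : ℕ → ModuleCat.{max u v} R := fun i => match i with
      | 0 => ModuleCat.of R X
      | _ + 1 => ModuleCat.of R PUnit
    have hG : ∀ i, Subsingleton (G (i + 1)) := fun i => inferInstanceAs (Subsingleton PUnit)
    refine ⟨{ F := fun i => G i, ε := LinearMap.id (M := X), d := fun i => 0, flat := ?_,
              surjective_ε := Function.surjective_id, exact_zero := ?_, exact_succ := ?_ }, ?_⟩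
    · rintro (_ | i)
      · exact h
      · exact isFlatModule_of_subsingleton _
    · intro z
      simp [eq_comm]
    · intro i z
      have := hG i
      exact ⟨fun _ => ⟨0, Subsingleton.elim _ _⟩, fun _ => rfl⟩
    · rintro (_ | i) hi
      · omega
      · exact hG i
  | succ k ih =>
    intro X _ _ h
    obtain ⟨P, hP⟩ := ih (X := freeSyzygy R X) h
    exact FlatResolution.exists_cons (isFlatModule_self.finsupp X) _
      (linearCombination_id_surjective X) P hP

/-! ### Flat dimension as injective dimension of the character module -/

open CategoryTheory

/-- The character module as an object of the category of right modules. -/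
abbrev charObj (R : Type u) [Ring R] (X : Type (max u v)) [AddCommGroup X] [Module R X] :
    ModuleCat.{max u v} Rᵐᵒᵖ := ModuleCat.of Rᵐᵒᵖ (CharDual R X)

theorem isFlatModule_iff_injective {X : Type (max u v)} [AddCommGroup X] [Module R X] :
    IsFlatModule R X ↔ Injective (charObj.{u, v} R X) := by
  rw [isFlatModule_iff_baer]
  constructor
  · intro h
    have := h.injective
    exact Module.injective_object_of_injective_module Rᵐᵒᵖ (CharDual R X)
  · intro h
    exact Module.Baer.of_injective (Module.injective_module_of_injective_object Rᵐᵒᵖ (CharDual R X))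

/-- Flat dimension shifting, expressed by the injective dimension of character modules. -/
theorem charObj_injectiveDimension_iff {X F : Type (max u v)} [AddCommGroup X] [Module R X]
    [AddCommGroup F] [Module R F] (hF : IsFlatModule R F) (f : F →ₗ[R] X)
    (hf : Function.Surjective f) (n : ℕ) :
    HasInjectiveDimensionLT (charObj.{u, v} R (LinearMap.ker f)) (n + 1) ↔
      HasInjectiveDimensionLT (charObj.{u, v} R X) (n + 2) := by
  have hex := CharDual.dual_exact (LinearMap.exact_subtype_ker_map f)
  let S : ShortComplex (ModuleCat.{max u v} Rᵐᵒᵖ) :=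
    ShortComplex.mk (X₁ := charObj.{u, v} R X) (X₂ := charObj.{u, v} R F)
      (X₃ := charObj.{u, v} R (LinearMap.ker f)) (ModuleCat.ofHom (CharDual.dual f))
      (ModuleCat.ofHom (CharDual.dual (LinearMap.ker f).subtype)) (by
        ext c : 2
        exact hex.apply_apply_eq_zero c)
  have hS : S.ShortExact :=
    { exact := (ShortComplex.ShortExact.moduleCat_exact_iff_function_exact S).2 hex
      mono_f := (ModuleCat.mono_iff_injective S.f).2 (CharDual.dual_injective hf)
      epi_g := (ModuleCat.epi_iff_surjective S.g).2
        (CharDual.dual_surjective (LinearMap.ker f).injective_subtype) }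
  -- The middle term of the dual sequence is injective because `F` is flat, so the dimension shifts
  -- by one.
  exact hS.hasInjectiveDimensionLT_X₃_iff n (isFlatModule_iff_injective.1 hF)

theorem flatDimLE_iff_injectiveDimension (k : ℕ) :
    ∀ {X : Type (max u v)} [AddCommGroup X] [Module R X],
    FlatDimLE.{u, v} R k X ↔ HasInjectiveDimensionLT (charObj.{u, v} R X) (k + 1) := by
  induction k with
  | zero =>
    intro X _ _
    exact isFlatModule_iff_injective.trans injective_iff_hasInjectiveDimensionLT_one
  | succ k ih =>
    intro X _ _
    exact (ih (X := freeSyzygy R X)).trans (charObj_injectiveDimension_iff.{u, v}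
      (isFlatModule_self.finsupp X) _ (linearCombination_id_surjective X) k)

/-- This takes any flat resolution, whereas `FlatDimLE` fixes one; the injective dimension of the
character module is the common invariant that makes the choice irrelevant. -/
theorem FlatResolution.injectiveDimension (k : ℕ) :
    ∀ {X : Type (max u v)} [AddCommGroup X] [Module R X] (P : FlatResolution.{u, max u v} R X),
    (∀ i, k < i → Subsingleton (P.F i)) →
    HasInjectiveDimensionLT (charObj.{u, v} R X) (k + 1) := by
  induction k with
  | zero =>
    intro X _ _ P hP
    have := hP 1 one_pos
    have hinj : Function.Injective P.ε := by
      rw [injective_iff_map_eq_zero]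
      intro z hz
      obtain ⟨t, rfl⟩ := (P.exact_zero z).1 hz
      rw [Subsingleton.elim t 0, map_zero]
    rw [← injective_iff_hasInjectiveDimensionLT_one, ← isFlatModule_iff_injective]
    exact .of_equiv (LinearEquiv.ofBijective P.ε ⟨hinj, P.surjective_ε⟩) (P.flat 0)
  | succ k ih =>
    intro X _ _ P hP
    obtain ⟨Q, hQ⟩ := P.exists_tail hP
    exact (charObj_injectiveDimension_iff.{u, v} (P.flat 0) P.ε P.surjective_ε k).1 (ih Q hQ)

theorem flatDimLE_iff_exists_resolution {k : ℕ} {X : Type (max u v)} [AddCommGroup X]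
    [Module R X] : FlatDimLE.{u, v} R k X ↔
      ∃ P : FlatResolution.{u, max u v} R X, ∀ i, k < i → Subsingleton (P.F i) :=
  ⟨fun h => h.exists_resolution, fun ⟨P, hP⟩ =>
    (flatDimLE_iff_injectiveDimension k).2 (P.injectiveDimension k hP)⟩

theorem flatDimension_le_iff {k : ℕ} {X : Type (max u v)} [AddCommGroup X] [Module R X] :
    flatDimension R X ≤ k ↔ FlatDimLE.{u, v} R k X := by
  rw [flatDimLE_iff_exists_resolution]
  constructor
  · intro h
    have hne : {e : ℕ∞ | ∃ (k : ℕ) (P : FlatResolution.{u, max u v} R X),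
        (∀ i, k < i → Subsingleton (P.F i)) ∧ e = k}.Nonempty := by
      rw [Set.nonempty_iff_ne_empty]
      intro h0
      rw [flatDimension, h0, sInf_empty, top_le_iff] at h
      exact ENat.natCast_ne_top k h
    obtain ⟨m, P, hP, hm⟩ := csInf_mem hne
    rw [flatDimension, hm, Nat.cast_le] at h
    exact ⟨P, fun i hi => hP i (by omega)⟩
  · rintro ⟨P, hP⟩
    exact sInf_le ⟨k, P, hP, rfl⟩

/-- The functorial free resolution does not commute with powers, so powers of an arbitrary flat
resolution are taken. -/
theorem FlatDimLE.pi {k : ℕ} {X : Type (max u v)} [AddCommGroup X] [Module R X]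
    (h : FlatDimLE.{u, v} R k X) (m : ℕ) : FlatDimLE.{u, v} R k (Fin m → X) := by
  obtain ⟨P, hP⟩ := h.exists_resolution
  rw [flatDimLE_iff_exists_resolution]
  have hex : ∀ {A B C : Type (max u v)} [AddCommGroup A] [AddCommGroup B] [AddCommGroup C]
      [Module R A] [Module R B] [Module R C] {f : A →ₗ[R] B} {g : B →ₗ[R] C},
      Function.Exact f g → Function.Exact (f.compLeft (Fin m)) (g.compLeft (Fin m)) := by
    intro A B C _ _ _ _ _ _ f g h z
    constructor
    · intro hz
      choose t ht using fun i => (h (z i)).1 (congrFun hz i)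
      exact ⟨t, funext ht⟩
    · rintro ⟨t, rfl⟩
      exact funext fun i => h.apply_apply_eq_zero (t i)
  exact ⟨{ F := fun i => Fin m → P.F i, ε := P.ε.compLeft (Fin m),
           d := fun i => (P.d i).compLeft (Fin m), flat := fun i => (P.flat i).pi (Fin m),
           surjective_ε := P.surjective_ε.comp_left, exact_zero := hex P.exact_zero,
           exact_succ := fun i => hex (P.exact_succ i) },
    fun i hi => by have := hP i hi; exact inferInstanceAs (Subsingleton (Fin m → P.F i))⟩

end FlatDimension

/-! ### Injective coresolutions -/

section Coresolution

variable {R : Type u} [Ring R]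

theorem LinearMap.exists_comp_eq_of_surjective {M : Type v} {N : Type w} {Q : Type x}
    [AddCommGroup M] [AddCommGroup N] [AddCommGroup Q] [Module R M] [Module R N] [Module R Q]
    (i : M →ₗ[R] N) (hi : Function.Surjective i) (f : M →ₗ[R] Q) (h : ∀ m, i m = 0 → f m = 0) :
    ∃ g : N →ₗ[R] Q, ∀ m, g (i m) = f m := by
  refine ⟨(LinearMap.ker i).liftQ f h ∘ₗ (i.quotKerEquivOfSurjective hi).symm.toLinearMap,
    fun m => ?_⟩
  have : (i.quotKerEquivOfSurjective hi).symm (i m) = Submodule.Quotient.mk m := by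
    rw [LinearEquiv.symm_apply_eq]
    rfl
  exact congrArg ((LinearMap.ker i).liftQ f h) this

/-- Baer's criterion gives extensions for modules in any universe, which allows coresolutions in
different universes to be compared. -/
theorem Module.Baer.exists_comp_eq {M : Type v} {N : Type w} {Q : Type x}
    [AddCommGroup M] [AddCommGroup N] [AddCommGroup Q] [Module R M] [Module R N] [Module R Q]
    (hQ : Module.Baer R Q) (i : M →ₗ[R] N) (f : M →ₗ[R] Q) (h : ∀ m, i m = 0 → f m = 0) :
    ∃ g : N →ₗ[R] Q, ∀ m, g (i m) = f m := by
  obtain ⟨g, hg⟩ := hQ.extension_property ((LinearMap.ker i).liftQ i le_rfl) (by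
    rw [← LinearMap.ker_eq_bot]
    exact Submodule.ker_liftQ_eq_bot _ _ _ le_rfl) ((LinearMap.ker i).liftQ f h)
  exact ⟨g, fun m => LinearMap.congr_fun hg (Submodule.Quotient.mk m)⟩

/-- An injective coresolution `0 → M → E⁰ → E¹ → ⋯`, not necessarily minimal. -/
structure BaerCoresolution (R : Type u) [Ring R] (M : Type v) [AddCommGroup M] [Module R M] where
  E : ℕ → Type w
  [addCommGroup : ∀ n, AddCommGroup (E n)]
  [module : ∀ n, Module R (E n)]
  ι : M →ₗ[R] E 0
  d : ∀ n, E n →ₗ[R] E (n + 1)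
  baer : ∀ n, Module.Baer R (E n)
  injective_ι : Function.Injective ι
  exact_zero : Function.Exact ι (d 0)
  exact_succ : ∀ n, Function.Exact (d n) (d (n + 1))

attribute [instance] BaerCoresolution.addCommGroup BaerCoresolution.module

/-- Forget minimality. -/
def MinimalInjectiveCoresolution.toBaer {M : Type v} [AddCommGroup M] [Module R M]
    (ξ : MinimalInjectiveCoresolution R M) : BaerCoresolution.{u, v, max u v} R M where
  E := ξ.E
  ι := ξ.ι
  d := ξ.d
  baer n := Module.Baer.of_injective (ξ.injective n)
  injective_ι := ξ.injective_ι
  exact_zero := ξ.exact_zero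
  exact_succ := ξ.exact_succ

theorem MinimalInjectiveCoresolution.essential_ker {M : Type v} [AddCommGroup M] [Module R M]
    (ξ : MinimalInjectiveCoresolution R M) (n : ℕ) :
    IsEssentialSubmodule (LinearMap.ker (ξ.d n)) := by
  cases n with
  | zero => rw [LinearMap.exact_iff.1 ξ.exact_zero]; exact ξ.essential_zero
  | succ n => rw [LinearMap.exact_iff.1 (ξ.exact_succ n)]; exact ξ.essential_succ n

namespace BaerCoresolution

variable {M : Type v} [AddCommGroup M] [Module R M]

/-- The coresolution of `Mᵐ` obtained from one of `M`. -/
def pi (A : BaerCoresolution.{u, v, w} R M) (m : ℕ) :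
    BaerCoresolution.{u, v, w} R (Fin m → M) where
  E n := Fin m → A.E n
  ι := A.ι.compLeft (Fin m)
  d n := (A.d n).compLeft (Fin m)
  baer n := by
    intro I g
    choose t ht using fun i => A.baer n I (LinearMap.proj i ∘ₗ g)
    exact ⟨LinearMap.pi t, fun z hz => funext fun i => ht i z hz⟩
  injective_ι := A.injective_ι.comp_left
  exact_zero z := by
    constructor
    · intro hz
      choose t ht using fun i => (A.exact_zero (z i)).1 (congrFun hz i)
      exact ⟨t, funext ht⟩
    · rintro ⟨t, rfl⟩
      exact funext fun i => A.exact_zero.apply_apply_eq_zero (t i)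
  exact_succ n z := by
    constructor
    · intro hz
      choose t ht using fun i => (A.exact_succ n (z i)).1 (congrFun hz i)
      exact ⟨t, funext ht⟩
    · rintro ⟨t, rfl⟩
      exact funext fun i => (A.exact_succ n).apply_apply_eq_zero (t i)

/-- The comparison map of coresolutions over a homomorphism of modules. -/
theorem exists_comparison {M' : Type x} [AddCommGroup M'] [Module R M']
    (A : BaerCoresolution.{u, x, y} R M') (B : BaerCoresolution.{u, v, w} R M)
    (f : M' →ₗ[R] M) : ∃ α : ∀ n, A.E n →ₗ[R] B.E n,
      (∀ m, α 0 (A.ι m) = B.ι (f m)) ∧ ∀ n z, α (n + 1) (A.d n z) = B.d n (α n z) := by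
  obtain ⟨α₀, h₀⟩ := (B.baer 0).exists_comp_eq A.ι (B.ι ∘ₗ f) (fun m hm => by
    rw [(injective_iff_map_eq_zero A.ι).1 A.injective_ι m hm, map_zero])
  -- Sending cocycles to cocycles is exactly what the next comparison map needs in order to exist,
  -- so it is carried through the recursion.
  let T : ℕ → Type (max y w) := fun n =>
    {a : A.E n →ₗ[R] B.E n // ∀ z, A.d n z = 0 → B.d n (a z) = 0}
  have hstep : ∀ n (a : T n), ∃ b : T (n + 1), ∀ z, b.1 (A.d n z) = B.d n (a.1 z) := by
    intro n a
    obtain ⟨b, hb⟩ := (B.baer (n + 1)).exists_comp_eq (A.d n) (B.d n ∘ₗ a.1) a.2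
    refine ⟨⟨b, fun z hz => ?_⟩, hb⟩
    obtain ⟨t, rfl⟩ := (A.exact_succ n z).1 hz
    rw [hb]
    exact (B.exact_succ n).apply_apply_eq_zero _
  choose step hs using hstep
  let a₀ : T 0 := ⟨α₀, fun z hz => by
    obtain ⟨t, rfl⟩ := (A.exact_zero z).1 hz
    rw [h₀]
    exact B.exact_zero.apply_apply_eq_zero _⟩
  let a : ∀ n, T n := fun n => Nat.rec a₀ step n
  exact ⟨fun n => (a n).1, h₀, fun n => hs n (a n)⟩

/-- A homomorphism `C → Eⁿ` is a coboundary if it lifts to `Eⁿ⁻¹`. -/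
def IsCoboundary (B : BaerCoresolution.{u, v, w} R M) {C : Type u} [AddCommGroup C] [Module R C] :
    ∀ n, (C →ₗ[R] B.E n) → Prop
  | 0, h => h = 0
  | n + 1, h => ∃ t : C →ₗ[R] B.E n, ∀ c, h c = B.d n (t c)

theorem IsCoboundary.exists_extension (B : BaerCoresolution.{u, v, w} R M) {C : Type u}
    [AddCommGroup C] [Module R C] {n : ℕ} {h : C →ₗ[R] B.E n} (hh : B.IsCoboundary n h)
    {P : Type u} [AddCommGroup P] [Module R P] (j : C →ₗ[R] P) (hj : Function.Injective j) :
    ∃ h' : P →ₗ[R] B.E n, (∀ c, h' (j c) = h c) ∧ ∀ p, B.d n (h' p) = 0 := by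
  cases n with
  | zero =>
    obtain rfl : h = 0 := hh
    exact ⟨0, by simp, by simp⟩
  | succ n =>
    obtain ⟨t, ht⟩ := hh
    obtain ⟨t', ht'⟩ := (B.baer n).exists_comp_eq j t (fun c hc => by
      rw [(injective_iff_map_eq_zero j).1 hj c hc, map_zero])
    exact ⟨B.d n ∘ₗ t', fun c => by simp [ht, ht'],
      fun p => (B.exact_succ n).apply_apply_eq_zero _⟩

/-- If the homomorphisms from finitely generated modules to `M` factor through the modules `M' i`,
then the cocycles `C → Eⁿ(M)` come from cocycles `C → Eⁿ(M' i)` up to coboundaries. -/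
theorem exists_approximation [IsNoetherianRing R] (B : BaerCoresolution.{u, v, w} R M)
    {ι : Type*} {M' : ι → Type x} [∀ i, AddCommGroup (M' i)] [∀ i, Module R (M' i)]
    (A : ∀ i, BaerCoresolution.{u, x, y} R (M' i)) (f : ∀ i, M' i →ₗ[R] M)
    (α : ∀ i n, (A i).E n →ₗ[R] B.E n) (hα₀ : ∀ i m, α i 0 ((A i).ι m) = B.ι (f i m))
    (hα : ∀ i n z, α i (n + 1) ((A i).d n z) = B.d n (α i n z))
    (hfac : ∀ (K : Type u) [AddCommGroup K] [Module R K] [Module.Finite R K] (φ : K →ₗ[R] M),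
      ∃ (i : ι) (φ' : K →ₗ[R] M' i), f i ∘ₗ φ' = φ) (n : ℕ) :
    ∀ (C : Type u) [AddCommGroup C] [Module R C] [Module.Finite R C] (g : C →ₗ[R] B.E n),
      (∀ c, B.d n (g c) = 0) → ∃ (i : ι) (g' : C →ₗ[R] (A i).E n),
        (∀ c, (A i).d n (g' c) = 0) ∧ B.IsCoboundary n (g - α i n ∘ₗ g') := by
  induction n with
  | zero =>
    intro C _ _ _ g hg
    let φ : C →ₗ[R] M := (LinearEquiv.ofInjective B.ι B.injective_ι).symm.toLinearMap ∘ₗ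
      g.codRestrict (LinearMap.range B.ι) (fun c => (B.exact_zero _).1 (hg c))
    have hφ : ∀ c, B.ι (φ c) = g c := fun c =>
      congrArg Subtype.val ((LinearEquiv.ofInjective B.ι B.injective_ι).apply_symm_apply _)
    obtain ⟨i, φ', hφ'⟩ := hfac C φ
    refine ⟨i, (A i).ι ∘ₗ φ', fun c => (A i).exact_zero.apply_apply_eq_zero _, ?_⟩
    refine LinearMap.ext fun c => ?_
    have : f i (φ' c) = φ c := LinearMap.congr_fun hφ' c
    simp [hα₀, this, hφ]
  | succ n ih =>
    intro C _ _ _ g hg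
    -- Dimension shifting along `0 → ker π → Rᵃ → C → 0`: `g ∘ π` lifts to `p`, whose restriction to
    -- the finitely generated `ker π` is a cocycle one degree lower.
    obtain ⟨a, π, hπ⟩ := Module.Finite.exists_fin' R C
    choose t ht using fun j => (B.exact_succ n (g (π (Pi.single j 1)))).1 (hg _)
    let p : (Fin a → R) →ₗ[R] B.E n := Fintype.linearCombination R t
    have hp : ∀ z, B.d n (p z) = g (π z) := by
      intro z
      conv_rhs => rw [pi_eq_sum_univ' z]
      simp [p, Fintype.linearCombination_apply, ht]
    let j := (LinearMap.ker π).subtype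
    have hj : Function.Injective j := Submodule.injective_subtype _
    obtain ⟨i, g', hg', hcob⟩ := ih (LinearMap.ker π) (p ∘ₗ j) (fun k => by
      change B.d n (p k.1) = 0
      rw [hp, LinearMap.mem_ker.1 k.2, map_zero])
    obtain ⟨p', hp'⟩ := ((A i).baer n).exists_comp_eq j g' (fun k hk => by
      rw [(injective_iff_map_eq_zero j).1 hj k hk, map_zero])
    obtain ⟨g'', hg''⟩ := π.exists_comp_eq_of_surjective hπ ((A i).d n ∘ₗ p') (fun z hz =>
      (congrArg ((A i).d n) (hp' ⟨z, hz⟩)).trans (hg' _))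
    obtain ⟨h', hh', hdh'⟩ := IsCoboundary.exists_extension B hcob j hj
    -- The three maps cancel on `ker π`, so their combination descends to `s`; as `d h' = 0`, the
    -- difference `g - α g''` is `d s`.
    obtain ⟨s, hs⟩ := π.exists_comp_eq_of_surjective hπ (p - α i n ∘ₗ p' - h') (fun z hz => by
      have h1 : h' z = p z - α i n (g' ⟨z, hz⟩) := hh' ⟨z, hz⟩
      have h2 : p' z = g' ⟨z, hz⟩ := hp' ⟨z, hz⟩
      simp [h1, h2])
    refine ⟨i, g'', fun c => ?_, s, fun c => ?_⟩
    · obtain ⟨z, rfl⟩ := hπ c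
      rw [hg'']
      exact ((A i).exact_succ n).apply_apply_eq_zero _
    · obtain ⟨z, rfl⟩ := hπ c
      simp [hs, hg'', hα, hp, hdh']

end BaerCoresolution

/-- If the cocycles are essential in every term of the coresolution `B`, then a homomorphism
cohomologous to an injective cocycle through a comparison map is injective. -/
theorem BaerCoresolution.injective_of_isCoboundary {M : Type v} [AddCommGroup M] [Module R M]
    (B : BaerCoresolution.{u, v, w} R M)
    (hB : ∀ n, IsEssentialSubmodule (LinearMap.ker (B.d n))) {n : ℕ} {C : Type u} [AddCommGroup C]
    [Module R C] {D : Type x} [AddCommGroup D] [Module R D] (g : C →ₗ[R] B.E n)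
    (hg : Function.Injective g) (α : D →ₗ[R] B.E n) (g' : C →ₗ[R] D)
    (h : B.IsCoboundary n (g - α ∘ₗ g')) : Function.Injective g' := by
  rw [injective_iff_map_eq_zero] at hg ⊢
  cases n with
  | zero =>
    intro c hc
    have : g c - α (g' c) = 0 := LinearMap.congr_fun h c
    rw [hc, map_zero, sub_zero] at this
    exact hg c this
  | succ n =>
    obtain ⟨t, ht⟩ := h
    have ht' : ∀ c, g' c = 0 → g c = B.d n (t c) := by
      intro c hc
      rw [← ht]
      simp [hc]
    have hbot := hB n ((LinearMap.ker g').map t) (by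
      rw [eq_bot_iff]
      rintro _ ⟨⟨c, hc, rfl⟩, hd⟩
      have : c = 0 := hg c ((ht' c hc).trans hd)
      simp [this])
    intro c hc
    have h0 : t c = 0 := by
      have : t c ∈ (LinearMap.ker g').map t := ⟨c, hc, rfl⟩
      rwa [hbot] at this
    exact hg c (by rw [ht' c hc, h0, map_zero])

/-- If the homomorphisms from finitely generated modules to `M` factor through modules which have
an injective coresolution with `n`-th term of flat dimension at most `k`, then the `n`-th term of
the minimal injective coresolution of `M` has flat dimension at most `k`. -/
theorem MinimalInjectiveCoresolution.flatDimLE [IsNoetherianRing R] {M : Type v} [AddCommGroup M]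
    [Module R M] (ξ : MinimalInjectiveCoresolution R M)
    {ι : Type*} {M' : ι → Type x} [∀ i, AddCommGroup (M' i)] [∀ i, Module R (M' i)]
    (A : ∀ i, BaerCoresolution.{u, x, max u y} R (M' i)) (f : ∀ i, M' i →ₗ[R] M)
    (hfac : ∀ (K : Type u) [AddCommGroup K] [Module R K] [Module.Finite R K] (φ : K →ₗ[R] M),
      ∃ (i : ι) (φ' : K →ₗ[R] M' i), f i ∘ₗ φ' = φ) (n k : ℕ)
    (hA : ∀ i, FlatDimLE.{u, y} R k ((A i).E n)) : FlatDimLE.{u, v} R k (ξ.E n) := by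
  choose α hα₀ hα using fun i => (A i).exists_comparison ξ.toBaer (f i)
  refine FlatDimLE.of_factors.{u, v, y} k fun C hC => ?_
  have : Module.Finite R C := Module.Finite.iff_fg.2 hC
  let Z : Submodule R C := (LinearMap.ker (ξ.d n)).comap C.subtype
  obtain ⟨a, π, hπ⟩ := Module.Finite.exists_fin' R Z
  let e := π.quotKerEquivOfSurjective hπ
  -- The quotient of `Rᵃ` is a copy of `Z` in the universe of `R`, as the approximation requires.
  obtain ⟨i, g', -, hcob⟩ := ξ.toBaer.exists_approximation A f α hα₀ hα hfac n
    ((Fin a → R) ⧸ LinearMap.ker π) (C.subtype ∘ₗ Z.subtype ∘ₗ e.toLinearMap) (fun c => (e c).2)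
  have hg' := ξ.toBaer.injective_of_isCoboundary ξ.essential_ker _
    (C.injective_subtype.comp (Z.injective_subtype.comp e.injective)) _ _ hcob
  obtain ⟨j, hj⟩ := ((A i).baer n).exists_comp_eq Z.subtype (g' ∘ₗ e.symm.toLinearMap)
    (fun z hz => by
      have : z = 0 := Z.injective_subtype (by simpa using hz)
      rw [this, map_zero])
  have hjinj : ∀ c, j c = 0 → c = 0 := by
    have hbot := ξ.essential_ker n ((LinearMap.ker j).map C.subtype) (by
      rw [eq_bot_iff]
      rintro _ ⟨⟨c, hc, rfl⟩, hd⟩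
      have h1 : g' (e.symm ⟨c, hd⟩) = 0 := (hj ⟨c, hd⟩).symm.trans hc
      have h2 := (injective_iff_map_eq_zero g').1 hg' _ h1
      have h3 : (⟨c, hd⟩ : Z) = 0 := by simpa using h2
      have h4 : c = 0 := congrArg Subtype.val h3
      simp [h4])
    intro c hc
    have : C.subtype c ∈ (LinearMap.ker j).map C.subtype := ⟨c, hc, rfl⟩
    rw [hbot] at this
    exact C.injective_subtype (by simpa using this)
  -- The map back comes from injectivity of `Eⁿ(M)`; the comparison map `α` would agree with the
  -- inclusion on `Z` only up to a coboundary.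
  obtain ⟨b, hb⟩ := (Module.Baer.of_injective (ξ.injective n)).exists_comp_eq j C.subtype (fun c hc => by
    rw [hjinj c hc, map_zero])
  exact ⟨(A i).E n, _, _, j, b, hA i, hb⟩

/-- A homomorphism from a finitely presented module to a direct limit factors through a term. -/
theorem Module.DirectLimit.exists_factorization {I : Type w} [Preorder I] [IsDirectedOrder I]
    [Nonempty I] [DecidableEq I] {G : I → Type x} [∀ i, AddCommGroup (G i)] [∀ i, Module R (G i)]
    (f : ∀ i j, i ≤ j → G i →ₗ[R] G j) [DirectedSystem G (fun i j h => f i j h)]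
    {K : Type v} [AddCommGroup K] [Module R K] {a : ℕ} (π : (Fin a → R) →ₗ[R] K)
    (hπ : Function.Surjective π) (hker : (LinearMap.ker π).FG)
    (φ : K →ₗ[R] Module.DirectLimit G f) :
    ∃ (i : I) (φ' : K →ₗ[R] G i), Module.DirectLimit.of R I G f i ∘ₗ φ' = φ := by
  choose i₀ y₀ hy₀ using fun j => Module.DirectLimit.exists_of (φ (π (Pi.single j 1)))
  obtain ⟨i₁, hi₁⟩ := Finite.exists_le i₀
  let p : (Fin a → R) →ₗ[R] G i₁ :=
    Fintype.linearCombination R fun j => f (i₀ j) i₁ (hi₁ j) (y₀ j)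
  have hp : ∀ z, Module.DirectLimit.of R I G f i₁ (p z) = φ (π z) := by
    intro z
    conv_rhs => rw [pi_eq_sum_univ' z]
    simp [p, Fintype.linearCombination_apply, hy₀]
  obtain ⟨rel, hrel⟩ := hker
  choose i₂ hi₂ hz₂ using fun l : rel => Module.DirectLimit.of.zero_exact (R := R) (f := f)
    (x := p l.1) (by
      have : l.1 ∈ LinearMap.ker π := hrel ▸ Submodule.subset_span l.2
      rw [hp, LinearMap.mem_ker.1 this, map_zero])
  -- Finitely many relations hold in the limit, so all of them hold already at a common later stage.
  obtain ⟨i₃, hi₃⟩ := Finite.exists_le i₂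
  obtain ⟨i, hi₃i, hi₁i⟩ := exists_ge_ge i₃ i₁
  have hle : LinearMap.ker π ≤ LinearMap.ker (f i₁ i hi₁i ∘ₗ p) := by
    rw [← hrel, Submodule.span_le]
    intro l hl
    have h1 : f (i₂ ⟨l, hl⟩) i ((hi₃ _).trans hi₃i) (f i₁ (i₂ ⟨l, hl⟩) (hi₂ _) (p l)) =
        f i₁ i hi₁i (p l) := DirectedSystem.map_map' (f := f) _ _ _
    change f i₁ i hi₁i (p l) = 0
    rw [← h1, hz₂ ⟨l, hl⟩, map_zero]
  obtain ⟨φ', hφ'⟩ := π.exists_comp_eq_of_surjective hπ (f i₁ i hi₁i ∘ₗ p) hle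
  refine ⟨i, φ', LinearMap.ext fun c => ?_⟩
  obtain ⟨z, rfl⟩ := hπ c
  simp [hφ', hp]

end Coresolution

/-! ### Direct limits and the supremum over flat modules -/

theorem theorem4p1 (R : Type u) [Ring R] [IsNoetherianRing R] :
    (∀ (n k : ℕ) (I : Type w) [Preorder I] [IsDirectedOrder I] [Nonempty I] [DecidableEq I]
      (G : I → Type x) [∀ i, AddCommGroup (G i)] [∀ i, Module R (G i)]
      (f : ∀ i j, i ≤ j → G i →ₗ[R] G j) [DirectedSystem G (fun i j h => f i j h)]
      (M : Type y) [AddCommGroup M] [Module R M] (_ : Module.DirectLimit G f ≃ₗ[R] M)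
      (ζ : ∀ i, MinimalInjectiveCoresolution R (G i)) (ξ : MinimalInjectiveCoresolution R M),
      (∀ i, flatDimension R ((ζ i).E n) ≤ k) → flatDimension R (ξ.E n) ≤ k) ∧
    (∀ (n : ℕ) (ξ : MinimalInjectiveCoresolution R R),
      flatDimension R (ξ.E n) =
        sSup {e : ℕ∞ | ∃ (F : Type (max u v)) (_ : AddCommGroup F) (_ : Module R F)
          (ζ : MinimalInjectiveCoresolution R F),
          IsFlatModule R F ∧ e = flatDimension R (ζ.E n)}) := by
  refine ⟨?_, fun n ξ => le_antisymm ?_ ?_⟩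
  · intro n k I _ _ _ _ G _ _ f _ M _ _ e ζ ξ h
    refine flatDimension_le_iff.{u, y}.2 (ξ.flatDimLE (fun i => (ζ i).toBaer)
      (fun i => e.toLinearMap ∘ₗ Module.DirectLimit.of R I G f i) ?_ n k
      (fun i => flatDimension_le_iff.{u, x}.1 (h i)))
    intro K _ _ _ φ
    obtain ⟨a, π, hπ⟩ := Module.Finite.exists_fin' R K
    obtain ⟨i, φ', hφ'⟩ := Module.DirectLimit.exists_factorization f π hπ
      (IsNoetherian.noetherian _) (e.symm.toLinearMap ∘ₗ φ)
    refine ⟨i, φ', LinearMap.ext fun c => ?_⟩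
    have : Module.DirectLimit.of R I G f i (φ' c) = e.symm (φ c) := LinearMap.congr_fun hφ' c
    simp [this]
  -- `R` is replaced by a flat copy in the universe of the supremum; a one-element family compares
  -- the two coresolutions.
  · obtain ⟨ζ⟩ := MinimalInjectiveCoresolution.nonempty R (ULift.{max u v} R)
    refine le_trans ?_ (le_sSup ⟨ULift.{max u v} R, _, _, ζ,
      .of_equiv ULift.moduleEquiv.symm isFlatModule_self, rfl⟩)
    generalize hm : flatDimension R (ζ.E n) = m
    induction m using ENat.recTopCoe with
    | top => exact le_top
    | coe k =>
    exact flatDimension_le_iff.{u, u}.2 (ξ.flatDimLE (ι := Unit) (fun _ => ζ.toBaer)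
      (fun _ => ULift.moduleEquiv.toLinearMap)
      (fun K _ _ _ φ => ⟨(), ULift.moduleEquiv.symm.toLinearMap ∘ₗ φ, rfl⟩) n k
      (fun _ => flatDimension_le_iff.{u, max u v}.1 hm.le))
  · refine sSup_le ?_
    rintro _ ⟨F, _, _, ζ, hF, rfl⟩
    generalize hm : flatDimension R (ξ.E n) = m
    induction m using ENat.recTopCoe with
    | top => exact le_top
    | coe k =>
    -- The family consists of all maps from finite free modules to `F`, each with the power of the
    -- coresolution of `R`.
    refine flatDimension_le_iff.{u, max u v}.2 (ζ.flatDimLE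
      (ι := Σ m : ℕ, (Fin m → R) →ₗ[R] F) (M' := fun i => Fin i.1 → R)
      (fun i => ξ.toBaer.pi i.1) (fun i => i.2) ?_ n k
      (fun i => (flatDimension_le_iff.{u, u}.1 hm.le).pi i.1))
    intro K _ _ _ φ
    obtain ⟨a, π, hπ⟩ := Module.Finite.exists_fin' R K
    obtain ⟨m, p, q, hpq⟩ := hF.exists_factorization π hπ (IsNoetherian.noetherian _) φ
    exact ⟨⟨m, q⟩, p, hpq⟩
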